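/- **Theorem.** Let $N\ge 1$, $K\ge 1$, $L\ge 0$ and $M\ge 2$ be integers. There are $N$ databases, each of which stores the same $K$ messages $W_1,\dots,W_K\in\{0,\dots,M-1\}^L$. A *private information retrieval (PIR) scheme* consists of random queries $Q_n^{[\theta]}$ ($1\le n\le N$, $1\le\theta\le K$), generated by the user without knowledge of the messages, and of (deterministic) answering functions of the databases: upon a query $q$, database $n$ returns a string of symbols of the alphabet $\{0,\dots,M-1\}$ that is a function of $q$ and $W_1,\dots,W_K$, and whose length depends only on $n$ and $q$. Writing $A_n^{[\theta]}$ for the answer to $Q_n^{[\theta]}$, and $|A_n^{[\theta]}|$ for its length, the scheme must satisfy the following. * Correctness: for every $\theta$ there is a decoding function which, for every choice of the messages, almost surely computes $W_\theta$ from $(A_1^{[\theta]},\dots,A_N^{[\theta]},Q_1^{[\theta]},\dots,Q_N^{[\theta]})$. * Privacy: for every $n$ and all $\theta,\theta'$, the queries $Q_n^{[\theta]}$ and $Q_n^{[\theta']}$ are identically distributed. No linearity is required. The *download cost* of a scheme is the maximum of $\sum_{n=1}^N|A_n^{[\theta]}|$ over all $\theta$ and all realizations of the queries (disregarding events of probability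 zero). Let $$C=\Bigl(1+\frac1N+\frac1{N^2}+\cdots+\frac1{N^{K-1}}\Bigr)^{-1}.$$ Then the minimum of the download cost over all PIR schemes with these parameters $N,K,L,M$ exists and equals $$D_L=\Bigl\lceil\frac LC\Bigr\rceil .$$ -/

import Mathlib

open MeasureTheory ProbabilityTheory

/-- The contents of the (replicated) databases: `K` messages, each a string of `L` symbols
over the `M`-ary alphabet `Fin M`. -/
abbrev Messages (K L M : ℕ) : Type := Fin K → Fin L → Fin M

/-- A private information retrieval scheme for `N` replicated databases, each storing the same
`K` messages of `L` symbols over an `M`-ary alphabet, with answers over the same alphabet.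
No linearity of any kind is required, and the queries may be arbitrary random variables. -/
structure PIRScheme (N K L M : ℕ) where
  /-- The user's private randomness. It is generated without knowledge of the messages. -/
  Ω : Type
  [measΩ : MeasurableSpace Ω]
  μ : Measure Ω
  [prob : IsProbabilityMeasure μ]
  /-- The set of possible queries to the database `n`. -/
  Query : Fin N → Type
  [measQuery : ∀ n, MeasurableSpace (Query n)]
  [singletonQuery : ∀ n, MeasurableSingletonClass (Query n)]
  /-- `query θ n` is the random query sent to database `n` when message `θ` is desired. -/
  query : Fin K → (n : Fin N) → Ω → Query n
  measurable_query : ∀ θ n, Measurable (query θ n)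
  /-- The number of symbols that database `n` returns upon a given query. -/
  answerLength : (n : Fin N) → Query n → ℕ
  /-- The answering string of database `n`, a function of the query it received and of the
  stored messages only. -/
  answer : (n : Fin N) → Query n → Messages K L M → List (Fin M)
  length_answer : ∀ n q W, (answer n q W).length = answerLength n q
  /-- The answers depend measurably on the query (the set of strings is countable). -/
  measurable_answer : ∀ n W a, MeasurableSet {q | answer n q W = a}
  /-- Correctness: the desired message is a function of the queries and the answers, whatever
  the messages are. -/
  correct : ∀ θ : Fin K,
    ∃ decode : (∀ n, Query n) → (Fin N → List (Fin M)) → (Fin L → Fin M),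
      ∀ W : Messages K L M, ∀ᵐ ω ∂μ,
        decode (fun n => query θ n ω) (fun n => answer n (query θ n ω) W) = W θ
  /-- Privacy: the query to each single database is identically distributed regardless of the
  desired message. -/
  isPrivate : ∀ (n : Fin N) (θ θ' : Fin K), IdentDistrib (query θ n) (query θ' n) μ μ

attribute [instance] PIRScheme.measΩ PIRScheme.prob PIRScheme.measQuery PIRScheme.singletonQuery

/-- `D` is the download cost of the scheme `S`: the maximum, over the desired message and the
realizations of the random queries, of the total number of symbols downloaded from all the
databases. Events of probability zero do not count as realizations; as the total is a natural
number, this maximum is the least almost sure upper bound. A scheme whose total download is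
unbounded has no download cost. -/
def PIRScheme.IsDownloadCost {N K L M : ℕ} (S : PIRScheme N K L M) (D : ℕ) : Prop :=
  IsLeast {d : ℕ | ∀ θ : Fin K, ∀ᵐ ω ∂S.μ, ∑ n, S.answerLength n (S.query θ n ω) ≤ d} D

/-- `C = (1 + 1/N + ⋯ + 1/N^(K-1))⁻¹`. -/
noncomputable def pirCapacity (N K : ℕ) : ℝ :=
  (∑ i ∈ Finset.range K, 1 / (N : ℝ) ^ i)⁻¹

/-! Converse. Regard the messages as uniform and let H(k, θ) be the mean, over the queries, of the
entropy of all answers for desired message θ given the first k messages. With message k, numbered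
from 0, decodable, H(k, k) is L symbols plus H(k + 1, k). Bounding a joint entropy by the sum over
the databases, changing the desired message in each summand by privacy, and bounding each summand by
the joint entropy gives H(k + 1, k + 1) ≤ N · H(k + 1, k). Iterating, the download is at least L(1 +
1/N + ⋯ + 1/N^(K-1)) = L / C (`answersEntropy_eq_add`, `answersEntropy_le_mul`).

Achievability. `sumScheme` retrieves N^(K-1) symbols at cost 1 + N + ⋯ + N^(K-1), which is exactly
rate C. Its sums are labelled by a set of messages and a walk of as many steps. If the sum contains
the desired message, its interference is the sum for the set without that message and the walk
without its last step, downloaded from a different database. A database thus never sees a symbol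
twice, and secret random bijections between labels and symbols hide the desired message.

The r < N^(K-1) leftover symbols use `cyclicScheme`, which retrieves up to N - 1 symbols at an
overhead of one. Although this is below rate C, the total loss stays under one symbol
(`exists_cost_lt`), so integrality makes the cost equal to the ceiling. -/

/-! ### Conditional entropy by counting fibres -/

section Entropy

variable {T α β γ ι : Type*} [Fintype T]

open Classical in
/-- The number of points at which `f` takes the value `a`. -/
noncomputable def fiberCard (f : T → α) (a : α) : ℕ :=
  (Finset.univ.filter fun s => f s = a).card

/-- The conditional entropy of `f` given `g` for a uniformly distributed point of `T`,
in nats and multiplied by the number of points of `T`. -/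
noncomputable def condEntropySum (g : T → β) (f : T → α) : ℝ :=
  ∑ t, (Real.log (fiberCard g (g t)) - Real.log (fiberCard (fun s => (g s, f s)) (g t, f t)))

lemma fiberCard_pos (f : T → α) (t : T) : 0 < fiberCard f (f t) :=
  Finset.card_pos.mpr ⟨t, by simp⟩

lemma fiberCard_le_fiberCard {f : T → α} {g : T → β} {a : α} {b : β}
    (h : ∀ s, f s = a → g s = b) : fiberCard f a ≤ fiberCard g b := by
  classical
  exact Finset.card_le_card fun s => by simpa using h s

lemma fiberCard_congr {f : T → α} {g : T → β} {a : α} {b : β}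
    (h : ∀ s, f s = a ↔ g s = b) : fiberCard f a = fiberCard g b :=
  le_antisymm (fiberCard_le_fiberCard fun s => (h s).1) (fiberCard_le_fiberCard fun s => (h s).2)

lemma fiberCard_le_card (f : T → α) (a : α) : fiberCard f a ≤ Fintype.card T := by
  classical
  exact Finset.card_le_univ _

lemma sum_comp_div_fiberCard [DecidableEq α] (f : T → α) (v : α → ℝ) :
    ∑ t, v (f t) / fiberCard f (f t) = ∑ a ∈ Finset.univ.image f, v a := by
  classical
  rw [Finset.sum_comp (fun a => v a / fiberCard f a) f]
  refine Finset.sum_congr rfl fun a ha => ?_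
  obtain ⟨t, -, rfl⟩ := Finset.mem_image.mp ha
  have : (fiberCard f (f t) : ℝ) ≠ 0 := by exact_mod_cast (fiberCard_pos f t).ne'
  rw [nsmul_eq_mul]
  have h : (Finset.univ.filter fun s => f s = f t).card = fiberCard f (f t) := by
    unfold fiberCard; congr!
  rw [h]
  field_simp

lemma sum_fiberCard_image [DecidableEq α] (f : T → α) :
    ∑ a ∈ Finset.univ.image f, (fiberCard f a : ℝ) = Fintype.card T := by
  rw [← sum_comp_div_fiberCard]
  have (t : T) : (fiberCard f (f t) : ℝ) / fiberCard f (f t) = 1 :=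
    div_self (by exact_mod_cast (fiberCard_pos f t).ne')
  simp [this]

lemma condEntropySum_nonneg (g : T → β) (f : T → α) : 0 ≤ condEntropySum g f := by
  refine Finset.sum_nonneg fun t _ => sub_nonneg.mpr (Real.log_le_log ?_ ?_)
  · exact_mod_cast fiberCard_pos (fun s => (g s, f s)) t
  · exact_mod_cast fiberCard_le_fiberCard fun s hs => (Prod.ext_iff.mp hs).1

lemma condEntropySum_le_card_mul_log (g : T → β) (f : T → α) :
    condEntropySum g f ≤ Fintype.card T * Real.log (Fintype.card T) := by
  rw [← nsmul_eq_mul, ← Finset.card_univ, ← Finset.sum_const]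
  refine Finset.sum_le_sum fun t _ => ?_
  have h1 : 0 ≤ Real.log (fiberCard (fun s => (g s, f s)) (g t, f t)) :=
    Real.log_natCast_nonneg _
  have h2 : Real.log (fiberCard g (g t)) ≤ Real.log (Fintype.card T) :=
    Real.log_le_log (by exact_mod_cast fiberCard_pos g t)
      (by exact_mod_cast fiberCard_le_card g _)
  rw [Finset.card_univ]
  linarith

/-- Conditional entropy is monotone in the conditioned variable. -/
lemma condEntropySum_mono (g : T → β) {f : T → α} {f' : T → γ}
    (h : ∀ s t, f' s = f' t → f s = f t) : condEntropySum g f ≤ condEntropySum g f' := by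
  refine Finset.sum_le_sum fun t _ => sub_le_sub_left (Real.log_le_log ?_ ?_) _
  · exact_mod_cast fiberCard_pos (fun s => (g s, f' s)) t
  · have : fiberCard (fun s => (g s, f' s)) (g t, f' t) ≤ fiberCard (fun s => (g s, f s)) (g t, f t) :=
      fiberCard_le_fiberCard fun s hs =>
        Prod.ext (Prod.ext_iff.mp hs).1 (h s t (Prod.ext_iff.mp hs).2)
    exact_mod_cast this

/-- The chain rule, for `f` that determines the first variable `e`. -/
lemma condEntropySum_eq_add {δ : Type*} (g : T → β) {e : T → γ} {f : T → α} {g' : T → δ}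
    (h : ∀ s t, f s = f t → e s = e t)
    (hg' : ∀ s t, g' s = g' t ↔ g s = g t ∧ e s = e t) :
    condEntropySum g f = condEntropySum g e + condEntropySum g' f := by
  unfold condEntropySum
  rw [← Finset.sum_add_distrib]
  refine Finset.sum_congr rfl fun t _ => ?_
  have h1 : fiberCard (fun s => (g s, e s)) (g t, e t) = fiberCard g' (g' t) :=
    fiberCard_congr fun s => by simp [hg']
  have h2 : fiberCard (fun s => (g s, f s)) (g t, f t)
      = fiberCard (fun s => (g' s, f s)) (g' t, f t) :=
    fiberCard_congr fun s => by
      simp only [Prod.mk.injEq, hg']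
      exact ⟨fun ⟨a, b⟩ => ⟨⟨a, h _ _ b⟩, b⟩, fun ⟨a, b⟩ => ⟨a.1, b⟩⟩
  rw [h1, h2]
  ring

/-- Gibbs' inequality: coding `f` by means of a (sub)probability `w` given `g` is no shorter than
the conditional entropy. -/
lemma condEntropySum_le_neg_sum_log (g : T → β) (f : T → α) (A : Finset α) (hA : ∀ t, f t ∈ A)
    (w : β → α → ℝ) (hw : ∀ b a, 0 ≤ w b a) (hpos : ∀ t, 0 < w (g t) (f t))
    (hsum : ∀ t, ∑ a ∈ A, w (g t) a ≤ 1) :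
    condEntropySum g f ≤ ∑ t, -Real.log (w (g t) (f t)) := by
  classical
  set p : T → β × α := fun s => (g s, f s)
  -- The likelihood ratio of `w` to the true conditional distribution has mean at most 1; the claim
  -- then follows from log x ≤ x - 1.
  have key : ∑ t, (fiberCard g (g t) * w (g t) (f t)) / fiberCard p (p t) ≤ Fintype.card T := by
    rw [sum_comp_div_fiberCard p fun x => fiberCard g x.1 * w x.1 x.2, ← sum_fiberCard_image g]
    calc _ ≤ ∑ x ∈ (Finset.univ.image g) ×ˢ A, fiberCard g x.1 * w x.1 x.2 := by
          refine Finset.sum_le_sum_of_subset_of_nonneg ?_ fun x _ _ =>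
            mul_nonneg (Nat.cast_nonneg _) (hw _ _)
          intro x hx
          obtain ⟨t, -, rfl⟩ := Finset.mem_image.mp hx
          exact Finset.mem_product.mpr ⟨Finset.mem_image_of_mem _ (Finset.mem_univ _), hA t⟩
      _ ≤ _ := by
          rw [Finset.sum_product]
          refine Finset.sum_le_sum fun b hb => ?_
          obtain ⟨t, -, rfl⟩ := Finset.mem_image.mp hb
          simp only
          rw [← Finset.mul_sum]
          exact mul_le_of_le_one_right (Nat.cast_nonneg _) (hsum t)
  rw [← sub_nonpos]
  unfold condEntropySum
  rw [← Finset.sum_sub_distrib]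
  calc _ ≤ ∑ t, ((fiberCard g (g t) * w (g t) (f t)) / fiberCard p (p t) - 1) := by
        refine Finset.sum_le_sum fun t _ => ?_
        have h1 : (0 : ℝ) < fiberCard g (g t) := by exact_mod_cast fiberCard_pos g t
        have h2 : (0 : ℝ) < fiberCard p (p t) := by exact_mod_cast fiberCard_pos p t
        have h3 := hpos t
        refine le_trans (le_of_eq ?_) (Real.log_le_sub_one_of_pos (by positivity))
        rw [Real.log_div (by positivity) h2.ne', Real.log_mul h1.ne' h3.ne']
        ring
    _ ≤ 0 := by
        rw [Finset.sum_sub_distrib]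
        simpa using key

/-- Gibbs' inequality with the uniform code on `A`. -/
lemma condEntropySum_le_of_card (g : T → β) (f : T → α) (A : Finset α) (hA : ∀ t, f t ∈ A) :
    condEntropySum g f ≤ Fintype.card T * Real.log A.card := by
  refine (condEntropySum_le_neg_sum_log g f A hA (fun _ _ => (A.card : ℝ)⁻¹)
    (fun _ _ => by positivity) (fun t => ?_) fun t => ?_).trans (le_of_eq ?_)
  · have := Finset.card_pos.mpr ⟨_, hA t⟩
    positivity
  · have : (A.card : ℝ) ≠ 0 := by exact_mod_cast (Finset.card_pos.mpr ⟨_, hA t⟩).ne'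
    simp [this]
  · simp

/-- Subadditivity of conditional entropy. -/
lemma condEntropySum_pi_le [Fintype ι] (g : T → β) (f : ι → T → α) :
    condEntropySum g (fun t i => f i t) ≤ ∑ i, condEntropySum g (f i) := by
  classical
  -- The code for the tuple is the product of the true conditional marginals.
  set w : β → ι → α → ℝ := fun b i a =>
    fiberCard (fun s => (g s, f i s)) (b, a) / fiberCard g b
  have hwpos (t : T) (i : ι) : 0 < w (g t) i (f i t) := by
    have h1 : (0 : ℝ) < fiberCard g (g t) := by exact_mod_cast fiberCard_pos g t
    have h2 : (0 : ℝ) < fiberCard (fun s => (g s, f i s)) (g t, f i t) := by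
      exact_mod_cast fiberCard_pos (fun s => (g s, f i s)) t
    exact div_pos h2 h1
  have hw1 (t : T) (i : ι) : ∑ a ∈ Finset.univ.image (f i), w (g t) i a ≤ 1 := by
    have h1 : (0 : ℝ) < fiberCard g (g t) := by exact_mod_cast fiberCard_pos g t
    simp only [w]
    rw [← Finset.sum_div, div_le_one h1]
    refine le_of_eq ?_
    norm_cast
    unfold fiberCard
    rw [Finset.card_eq_sum_card_fiberwise (f := f i) (t := Finset.univ.image (f i))
      fun s _ => by simp]
    refine Finset.sum_congr rfl fun a _ => congrArg _ ?_
    ext s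
    simp
  refine (condEntropySum_le_neg_sum_log g _ (Fintype.piFinset fun i => Finset.univ.image (f i))
    (fun t => by simp) (fun b a => ∏ i, w b i (a i))
    (fun b a => Finset.prod_nonneg fun i _ => by positivity)
    (fun t => Finset.prod_pos fun i _ => hwpos t i) fun t => ?_).trans (le_of_eq ?_)
  · rw [← Finset.prod_univ_sum]
    exact Finset.prod_le_one (fun i _ => Finset.sum_nonneg fun a _ => by positivity)
      fun i _ => hw1 t i
  · unfold condEntropySum
    rw [Finset.sum_comm]
    refine Finset.sum_congr rfl fun t _ => ?_
    rw [Real.log_prod fun i _ => (hwpos t i).ne', ← Finset.sum_neg_distrib]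
    refine Finset.sum_congr rfl fun i _ => ?_
    have h1 : (0 : ℝ) < fiberCard g (g t) := by exact_mod_cast fiberCard_pos g t
    have h2 : (0 : ℝ) < fiberCard (fun s => (g s, f i s)) (g t, f i t) := by
      exact_mod_cast fiberCard_pos (fun s => (g s, f i s)) t
    simp only [w]
    rw [Real.log_div h2.ne' h1.ne']
    ring

end Entropy

/-! ### The converse bound -/

section Converse

variable {N K L M : ℕ}

/-- The first `k` messages. -/
def initialMessages (k : ℕ) (W : Messages K L M) (i : {i : Fin K // i.1 < k}) : Fin L → Fin M :=
  W i

lemma fiberCard_initialMessages (k : ℕ) (W : Messages K L M) :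
    fiberCard (initialMessages k) (initialMessages k W)
      = ∏ i : Fin K, if i.1 < k then 1 else M ^ L := by
  classical
  have h : (Finset.univ.filter fun V : Messages K L M => initialMessages k V = initialMessages k W)
      = Fintype.piFinset fun i : Fin K => if i.1 < k then {W i} else Finset.univ := by
    ext V
    simp only [Finset.mem_filter, Finset.mem_univ, true_and, Fintype.mem_piFinset, funext_iff,
      initialMessages, Subtype.forall]
    refine forall_congr' fun i => ?_
    split_ifs with hi <;> simp [hi, funext_iff]
  have h' : fiberCard (initialMessages k) (initialMessages k W)
      = (Finset.univ.filter fun V : Messages K L M =>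
          initialMessages k V = initialMessages k W).card := by
    unfold fiberCard; congr!
  rw [h', h, Fintype.card_piFinset]
  refine Finset.prod_congr rfl fun i _ => ?_
  split_ifs <;> simp

lemma initialMessages_succ_eq_iff {k : ℕ} (hk : k < K) (V W : Messages K L M) :
    initialMessages (k + 1) V = initialMessages (k + 1) W ↔
      initialMessages k V = initialMessages k W ∧ V ⟨k, hk⟩ = W ⟨k, hk⟩ := by
  simp only [funext_iff (f := initialMessages _ _), initialMessages, Subtype.forall]
  refine ⟨fun h => ⟨fun i hi => h i (by omega), h ⟨k, hk⟩ (by simp)⟩, fun ⟨h, h'⟩ i hi => ?_⟩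
  rcases Nat.lt_succ_iff_lt_or_eq.mp hi with hi | hi
  · exact h i hi
  · obtain rfl : i = ⟨k, hk⟩ := Fin.ext hi
    exact h'

/-- Fixing one more message divides the size of every fibre by `M ^ L`. -/
lemma condEntropySum_message (hM : 0 < M) {k : ℕ} (hk : k < K) :
    condEntropySum (initialMessages k) (fun W : Messages K L M => W ⟨k, hk⟩)
      = Fintype.card (Messages K L M) * Real.log M * L := by
  have hM' : ((M : ℝ) ^ L) ≠ 0 := by positivity
  unfold condEntropySum
  have (W : Messages K L M) : fiberCard (fun s => (initialMessages k s, s ⟨k, hk⟩))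
      (initialMessages k W, W ⟨k, hk⟩)
        = fiberCard (initialMessages (k + 1)) (initialMessages (k + 1) W) :=
    fiberCard_congr fun V => by simp [initialMessages_succ_eq_iff hk]
  simp only [this, fiberCard_initialMessages]
  rw [Finset.sum_const, Finset.card_univ, nsmul_eq_mul, mul_assoc]
  congr 1
  push_cast
  rw [Real.log_prod fun i _ => by split_ifs <;> simp [hM'],
    Real.log_prod fun i _ => by split_ifs <;> simp [hM'], ← Finset.sum_sub_distrib,
    Finset.sum_eq_single ⟨k, hk⟩]
  · simp [mul_comm]
  · intro i _ hi
    have : i.1 ≠ k := fun h => hi (Fin.ext h)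
    have h2 : i.1 < k + 1 ↔ i.1 < k := by omega
    simp [h2]
  · simp

namespace PIRScheme

variable (S : PIRScheme N K L M)

/-- All the answers to given queries, as a function of the messages. -/
def answers (q : ∀ n, S.Query n) (W : Messages K L M) (n : Fin N) : List (Fin M) :=
  S.answer n (q n) W

/-- Functions of a query that factor through the answering function are measurable. -/
lemma measurable_comp_answer (n : Fin N) (φ : (Messages K L M → List (Fin M)) → ℝ) :
    Measurable fun q => φ (S.answer n q) := by
  -- There are finitely many messages and countably many strings, so the answering functions form a
  -- countable set, and preimages of points suffice.
  let _ : MeasurableSpace (Messages K L M → List (Fin M)) := ⊤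
  refine (measurable_from_top (f := φ)).comp (measurable_to_countable' fun a => ?_)
  have : S.answer n ⁻¹' {a} = ⋂ W, {q | S.answer n q W = a W} := by
    ext q
    simp [funext_iff]
  rw [this]
  exact MeasurableSet.iInter fun W => S.measurable_answer n W (a W)

lemma measurable_comp_answers (θ : Fin K)
    (φ : (Messages K L M → Fin N → List (Fin M)) → ℝ) :
    Measurable fun ω => φ (S.answers fun n => S.query θ n ω) := by
  let _ : MeasurableSpace (Messages K L M → Fin N → List (Fin M)) := ⊤
  refine (measurable_from_top (f := φ)).comp (measurable_to_countable' fun a => ?_)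
  have : (fun ω => S.answers fun n => S.query θ n ω) ⁻¹' {a}
      = ⋂ W, ⋂ n, S.query θ n ⁻¹' {q | S.answer n q W = a W n} := by
    ext q
    simp [funext_iff, answers]
  rw [this]
  exact MeasurableSet.iInter fun W => MeasurableSet.iInter fun n =>
    S.measurable_query θ n (S.measurable_answer n W (a W n))

/-- The average conditional entropy of the answers when message `θ` is desired, given the first
`k` messages. -/
noncomputable def answersEntropy (k : ℕ) (θ : Fin K) : ℝ :=
  ∫ ω, condEntropySum (initialMessages k) (S.answers fun n => S.query θ n ω) ∂S.μ

lemma integrable_answersEntropy (k : ℕ) (θ : Fin K) : Integrable (fun ω =>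
    condEntropySum (initialMessages k) (S.answers fun n => S.query θ n ω)) S.μ := by
  refine Integrable.of_bound
    (S.measurable_comp_answers θ (condEntropySum (initialMessages k))).aestronglyMeasurable
    (Fintype.card (Messages K L M) * Real.log (Fintype.card (Messages K L M))) ?_
  refine Filter.Eventually.of_forall fun ω => ?_
  rw [Real.norm_of_nonneg (condEntropySum_nonneg _ _)]
  exact condEntropySum_le_card_mul_log _ _

lemma integrable_answerEntropy (k : ℕ) (θ : Fin K) (n : Fin N) : Integrable (fun ω =>
    condEntropySum (initialMessages k) (S.answer n (S.query θ n ω))) S.μ := by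
  refine Integrable.of_bound ((S.measurable_comp_answer n
    (condEntropySum (initialMessages k))).comp (S.measurable_query θ n)).aestronglyMeasurable
    (Fintype.card (Messages K L M) * Real.log (Fintype.card (Messages K L M))) ?_
  refine Filter.Eventually.of_forall fun ω => ?_
  rw [Real.norm_of_nonneg (condEntropySum_nonneg _ _)]
  exact condEntropySum_le_card_mul_log _ _

lemma answersEntropy_nonneg (k : ℕ) (θ : Fin K) : 0 ≤ S.answersEntropy k θ :=
  integral_nonneg fun _ => condEntropySum_nonneg _ _

/-- The download cost bounds the entropy of the answers. -/
lemma answersEntropy_le {D : ℕ} (k : ℕ) (θ : Fin K)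
    (hD : ∀ᵐ ω ∂S.μ, ∑ n, S.answerLength n (S.query θ n ω) ≤ D) :
    S.answersEntropy k θ ≤ Fintype.card (Messages K L M) * Real.log M * D := by
  have h : ∀ᵐ ω ∂S.μ, condEntropySum (initialMessages k) (S.answers fun n => S.query θ n ω)
      ≤ Fintype.card (Messages K L M) * Real.log M * D := by
    filter_upwards [hD] with ω hω
    refine (condEntropySum_pi_le _ _).trans ?_
    have h1 (n : Fin N) : condEntropySum (initialMessages k) (fun W =>
        S.answers (fun n => S.query θ n ω) W n)
        ≤ Fintype.card (Messages K L M) * Real.log M * S.answerLength n (S.query θ n ω) := by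
      classical
      refine (condEntropySum_le_of_card _ _ (Finset.univ.image fun v :
        List.Vector (Fin M) (S.answerLength n (S.query θ n ω)) => v.toList) fun W => ?_).trans ?_
      · exact Finset.mem_image.mpr ⟨⟨_, S.length_answer n _ W⟩, Finset.mem_univ _, rfl⟩
      · rw [Finset.card_image_of_injective _ List.Vector.toList_injective, Finset.card_univ, card_vector,
          Fintype.card_fin, Nat.cast_pow, Real.log_pow]
        exact le_of_eq (by ring)
    refine (Finset.sum_le_sum fun n _ => h1 n).trans ?_
    rw [← Finset.mul_sum]
    refine mul_le_mul_of_nonneg_left ?_ (mul_nonneg (Nat.cast_nonneg _) (Real.log_natCast_nonneg _))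
    exact_mod_cast hω
  simpa [answersEntropy] using
    integral_mono_ae (S.integrable_answersEntropy k θ) (integrable_const _) h

/-- By correctness, the answers contain the desired message. -/
lemma answersEntropy_eq_add (hM : 0 < M) {k : ℕ} (hk : k < K) :
    S.answersEntropy k ⟨k, hk⟩ = Fintype.card (Messages K L M) * Real.log M * L
      + S.answersEntropy (k + 1) ⟨k, hk⟩ := by
  obtain ⟨decode, hdecode⟩ := S.correct ⟨k, hk⟩
  have h : ∀ᵐ ω ∂S.μ,
      condEntropySum (initialMessages k) (S.answers fun n => S.query ⟨k, hk⟩ n ω)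
        = Fintype.card (Messages K L M) * Real.log M * L
        + condEntropySum (initialMessages (k + 1)) (S.answers fun n => S.query ⟨k, hk⟩ n ω) := by
    filter_upwards [ae_all_iff.mpr hdecode] with ω hω
    rw [← condEntropySum_message hM hk]
    refine condEntropySum_eq_add _ (fun V W hVW => ?_) (initialMessages_succ_eq_iff hk)
    rw [← hω V, ← hω W]
    exact congrArg _ hVW
  unfold answersEntropy
  rw [integral_congr_ae h, integral_add (integrable_const _) (S.integrable_answersEntropy _ _)]
  simp

/-- By privacy, the desired message can be replaced at the cost of a factor `N`. -/
lemma answersEntropy_le_mul (k : ℕ) (θ θ' : Fin K) :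
    S.answersEntropy k θ' ≤ N * S.answersEntropy k θ := by
  calc S.answersEntropy k θ'
      ≤ ∫ ω, ∑ n, condEntropySum (initialMessages k) (S.answer n (S.query θ' n ω)) ∂S.μ :=
        integral_mono (S.integrable_answersEntropy k θ')
          (integrable_finsetSum _ fun n _ => S.integrable_answerEntropy k θ' n)
          fun ω => condEntropySum_pi_le _ fun n W => S.answer n (S.query θ' n ω) W
    _ = ∑ n, ∫ ω, condEntropySum (initialMessages k) (S.answer n (S.query θ' n ω)) ∂S.μ :=
        integral_finsetSum _ fun n _ => S.integrable_answerEntropy k θ' n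
    _ = ∑ n, ∫ ω, condEntropySum (initialMessages k) (S.answer n (S.query θ n ω)) ∂S.μ :=
        Finset.sum_congr rfl fun n _ => ((S.isPrivate n θ' θ).comp
          (S.measurable_comp_answer n (condEntropySum (initialMessages k)))).integral_eq
    _ ≤ ∑ n : Fin N, S.answersEntropy k θ := by
        refine Finset.sum_le_sum fun n _ => integral_mono (S.integrable_answerEntropy k θ n)
          (S.integrable_answersEntropy k θ) fun ω => condEntropySum_mono _ fun V W h => ?_
        exact congrFun h n
    _ = N * S.answersEntropy k θ := by simp

/-- Here `j` counts the messages after `k`. Each induction step peels off message `k` and passes to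
`k + 1` by privacy, which costs the factor `1 / N`. -/
lemma mul_sum_le_answersEntropy (hN : 0 < N) (hM : 0 < M) (j k : ℕ) (hk : k < K)
    (hj : k + j + 1 = K) :
    Fintype.card (Messages K L M) * Real.log M * L * ∑ i ∈ Finset.range (j + 1), 1 / (N : ℝ) ^ i
      ≤ S.answersEntropy k ⟨k, hk⟩ := by
  have hN' : (0 : ℝ) < N := by exact_mod_cast hN
  induction j generalizing k with
  | zero =>
    rw [S.answersEntropy_eq_add hM hk]
    simpa using S.answersEntropy_nonneg _ _
  | succ j ih =>
    rw [S.answersEntropy_eq_add hM hk, Finset.sum_range_succ', mul_add, add_comm]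
    refine add_le_add (by simp) ?_
    have h1 := (ih (k + 1) (by omega) (by omega)).trans
      (S.answersEntropy_le_mul (k + 1) ⟨k, hk⟩ ⟨k + 1, by omega⟩)
    have h2 : ∑ i ∈ Finset.range (j + 1), 1 / (N : ℝ) ^ (i + 1)
        = (∑ i ∈ Finset.range (j + 1), 1 / (N : ℝ) ^ i) / N := by
      rw [Finset.sum_div]
      exact Finset.sum_congr rfl fun i _ => by rw [pow_succ, div_div]
    rw [h2, ← mul_div_assoc, div_le_iff₀ hN', mul_comm _ (N : ℝ)]
    exact h1

/-- The converse: the download cost is at least `L / C`. -/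
theorem div_pirCapacity_le {D : ℕ} (hN : 1 ≤ N) (hK : 1 ≤ K) (hM : 2 ≤ M)
    (hD : S.IsDownloadCost D) : (L : ℝ) / pirCapacity N K ≤ D := by
  have h1 := S.mul_sum_le_answersEntropy hN (by omega) (K - 1) 0 hK (by omega)
  have h2 := h1.trans (S.answersEntropy_le 0 ⟨0, hK⟩ (hD.1 ⟨0, hK⟩))
  rw [Nat.sub_add_cancel hK, mul_assoc] at h2
  have : Nonempty (Messages K L M) := ⟨fun _ _ => ⟨0, by omega⟩⟩
  have hT : (0 : ℝ) < Fintype.card (Messages K L M) := by exact_mod_cast Fintype.card_pos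
  have hlog : 0 < Real.log M := Real.log_pos (by exact_mod_cast hM)
  rw [pirCapacity, div_inv_eq_mul]
  exact le_of_mul_le_mul_left h2 (mul_pos hT hlog)

end PIRScheme

end Converse

/-! ### Finite schemes and the scheme for short messages -/

/-- A scheme for messages with symbols in `A` indexed by `Λ`, driven by finite uniform randomness,
with answers whose lengths do not depend on the queries. The answering functions themselves serve
as the queries. -/
structure FiniteScheme (N K : ℕ) (Λ A : Type) where
  Ω : Type
  [fintypeΩ : Fintype Ω]
  [nonemptyΩ : Nonempty Ω]
  /-- The positions of the answering string of a database. -/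
  Index : Fin N → Type
  [fintypeIndex : ∀ n, Fintype (Index n)]
  answer : Fin K → (n : Fin N) → Ω → (Fin K → Λ → A) → Index n → A
  correct : ∀ θ ω W W', (∀ n, answer θ n ω W = answer θ n ω W') → W θ = W' θ
  isPrivate : ∀ n θ θ', ∃ σ : Equiv.Perm Ω, ∀ ω, answer θ n (σ ω) = answer θ' n ω

attribute [instance] FiniteScheme.fintypeΩ FiniteScheme.nonemptyΩ FiniteScheme.fintypeIndex

namespace FiniteScheme

variable {N K : ℕ} {Λ Λ' A : Type}

/-- The number of downloaded symbols. -/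
def cost (S : FiniteScheme N K Λ A) : ℕ := ∑ n, Fintype.card (S.Index n)

/-- The scheme that downloads nothing, for messages without symbols. -/
def trivialScheme [IsEmpty Λ] : FiniteScheme N K Λ A where
  Ω := Unit
  Index _ := Empty
  answer _ _ _ _ := Empty.elim
  correct _ _ _ _ _ := Subsingleton.elim _ _
  isPrivate _ _ _ := ⟨Equiv.refl _, fun _ => rfl⟩

/-- Renaming the positions of the message symbols. -/
def congr (S : FiniteScheme N K Λ A) (e : Λ ≃ Λ') : FiniteScheme N K Λ' A where
  Ω := S.Ω
  Index := S.Index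
  answer θ n ω W := S.answer θ n ω fun k i => W k (e i)
  correct θ ω W W' h := by
    ext i
    simpa using congrFun (S.correct θ ω _ _ h) (e.symm i)
  isPrivate n θ θ' := by
    obtain ⟨σ, hσ⟩ := S.isPrivate n θ θ'
    exact ⟨σ, fun ω => by rw [hσ]⟩

/-- Independent use of two schemes for two parts of the messages. -/
def sum (S : FiniteScheme N K Λ A) (S' : FiniteScheme N K Λ' A) :
    FiniteScheme N K (Λ ⊕ Λ') A where
  Ω := S.Ω × S'.Ω
  Index n := S.Index n ⊕ S'.Index n
  answer θ n ω W := Sum.elim (S.answer θ n ω.1 fun k i => W k (.inl i))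
    (S'.answer θ n ω.2 fun k i => W k (.inr i))
  correct θ ω W W' h := by
    have h1 := S.correct θ ω.1 (fun k i => W k (.inl i)) (fun k i => W' k (.inl i)) fun n =>
      funext fun i => congrFun (h n) (.inl i)
    have h2 := S'.correct θ ω.2 (fun k i => W k (.inr i)) (fun k i => W' k (.inr i)) fun n =>
      funext fun i => congrFun (h n) (.inr i)
    ext (i | i)
    · exact congrFun h1 i
    · exact congrFun h2 i
  isPrivate n θ θ' := by
    obtain ⟨σ, hσ⟩ := S.isPrivate n θ θ'
    obtain ⟨σ', hσ'⟩ := S'.isPrivate n θ θ'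
    exact ⟨σ.prodCongr σ', fun ω => by simp [hσ, hσ']⟩

/-- A word preceded by a zero. -/
def consZero [Zero A] {L : ℕ} (w : Fin L → A) : Fin (L + 1) → A := Fin.cons 0 w

/-- The scheme that asks each of `L + 1` databases for a single sum of one symbol of each message,
the desired message contributing a different symbol, or nothing, at each of the databases. -/
def cyclicScheme [AddCommGroup A] {L : ℕ} (hL : L + 1 ≤ N) : FiniteScheme N K (Fin L) A where
  Ω := Fin K → Fin (L + 1)
  Index n := Fin (if n.1 < L + 1 then 1 else 0)
  answer θ n F W _ := ∑ k, consZero (W k) (F k + if k = θ then Fin.ofNat (L + 1) n else 0)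
  correct θ F W W' h := by
    have key (V : Fin K → Fin L → A) (j : Fin (L + 1)) :
        ∑ k, consZero (V k) (F k + if k = θ then j - F θ else 0)
          = consZero (V θ) j + ∑ k ∈ Finset.univ.erase θ, consZero (V k) (F k) := by
      rw [← Finset.add_sum_erase _ _ (Finset.mem_univ θ)]
      congr 1
      · simp
      · refine Finset.sum_congr rfl fun k hk => ?_
        simp [Finset.ne_of_mem_erase hk]
    have h1 (j : Fin (L + 1)) :
        consZero (W θ) j + ∑ k ∈ Finset.univ.erase θ, consZero (W k) (F k)
          = consZero (W' θ) j + ∑ k ∈ Finset.univ.erase θ, consZero (W' k) (F k) := by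
      rw [← key, ← key]
      have hlt := (j - F θ).isLt
      -- Database `j - F θ` is the one asked for position `j` of the desired message.
      have := congrFun (h ⟨(j - F θ).1, by omega⟩) ⟨0, by
        rw [if_pos hlt]; exact one_pos⟩
      simpa using this
    -- Position 0 is the padding zero: that answer is the interference alone.
    have h2 := h1 0
    simp only [consZero, Fin.cons_zero, zero_add] at h2
    ext i
    have h3 := h1 i.succ
    simp only [consZero, Fin.cons_succ] at h3
    rw [h2] at h3
    exact add_right_cancel h3
  isPrivate n θ θ' := by
    refine ⟨Equiv.addRight fun k => (if k = θ' then Fin.ofNat (L + 1) n else 0)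
      - (if k = θ then Fin.ofNat (L + 1) n else 0), fun F => ?_⟩
    ext W i
    refine Finset.sum_congr rfl fun k _ => congrArg _ ?_
    simp [add_assoc]

lemma cost_cyclicScheme [AddCommGroup A] {L : ℕ} (hL : L + 1 ≤ N) :
    (cyclicScheme hL : FiniteScheme N K (Fin L) A).cost = L + 1 := by
  have : ∀ n : Fin N, Fintype.card ((cyclicScheme hL : FiniteScheme N K (Fin L) A).Index n)
      = if n.1 < L + 1 then 1 else 0 := fun n => Fintype.card_fin _
  simp only [cost, this]
  rw [Fin.sum_univ_eq_sum_range (fun n => if n < L + 1 then 1 else 0) N, Finset.sum_boole]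
  have : (Finset.range N).filter (· < L + 1) = Finset.range (L + 1) := by
    ext n
    simp only [Finset.mem_filter, Finset.mem_range]
    omega
  rw [this, Nat.cast_id, Finset.card_range]

end FiniteScheme

/-! ### Counting walks -/

section Walks

variable {N : ℕ} [NeZero N]

/-- The databases by which a walk, listed from its end, can be continued: a walk starts at the
database `0`, and consecutive databases are distinct. -/
def walkSuccessors : List (Fin N) → Finset (Fin N)
  | [] => {0}
  | m :: _ => Finset.univ.erase m

variable (N) in
/-- The walks through a given number of databases. -/
def walks : ℕ → Finset (List (Fin N))
  | 0 => {[]}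
  | s + 1 => (walks s).biUnion fun w => (walkSuccessors w).image (· :: w)

lemma cons_mem_walks {s : ℕ} {n : Fin N} {w : List (Fin N)} :
    n :: w ∈ walks N (s + 1) ↔ w ∈ walks N s ∧ n ∈ walkSuccessors w := by
  simp [walks]

lemma exists_eq_cons_of_mem_walks {s : ℕ} {w : List (Fin N)} (h : w ∈ walks N (s + 1)) :
    ∃ n w', w = n :: w' := by
  simp only [walks, Finset.mem_biUnion, Finset.mem_image] at h
  obtain ⟨w', -, n, -, rfl⟩ := h
  exact ⟨n, w', rfl⟩

lemma card_walks_succ (s : ℕ) : (walks N (s + 1)).card = (N - 1) ^ s := by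
  have h (s : ℕ) : (walks N (s + 1)).card = ∑ w ∈ walks N s, (walkSuccessors w).card := by
    rw [walks, Finset.card_biUnion]
    · exact Finset.sum_congr rfl fun w _ =>
        Finset.card_image_of_injective _ fun a b hab => (List.cons.inj hab).1
    · intro w _ w' _ hne
      rw [Function.onFun, Finset.disjoint_left]
      intro v hv hv'
      obtain ⟨a, -, rfl⟩ := Finset.mem_image.mp hv
      obtain ⟨b, -, hb⟩ := Finset.mem_image.mp hv'
      exact hne (List.cons.inj hb).2.symm
  induction s with
  | zero => rw [h]; simp [walks, walkSuccessors]
  | succ s ih =>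
    rw [h, Finset.sum_congr rfl (g := fun _ => N - 1), Finset.sum_const, ih, smul_eq_mul, pow_succ]
    intro w hw
    obtain ⟨n, w', rfl⟩ := exists_eq_cons_of_mem_walks hw
    simp [walkSuccessors]

/-- Binomial theorem over the subsets of the other messages. -/
lemma sum_pow_card_sub_one_of_mem {K : ℕ} (k : Fin K) (a : ℕ) :
    ∑ S : Finset (Fin K) with k ∈ S, a ^ (S.card - 1) = (a + 1) ^ (K - 1) := by
  have h := Finset.sum_pow_mul_eq_add_pow a 1 (Finset.univ.erase k)
  simp only [one_pow, mul_one, Finset.card_erase_of_mem (Finset.mem_univ k), Finset.card_univ,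
    Fintype.card_fin] at h
  rw [← h]
  refine Finset.sum_nbij' (fun S => S.erase k) (fun T => insert k T) ?_ ?_ ?_ ?_ ?_
  · intro S _
    simp [Finset.erase_subset_erase]
  · simp
  · intro S hS
    exact Finset.insert_erase (by simpa using hS)
  · intro T hT
    exact Finset.erase_insert fun hk => by simpa using Finset.mem_powerset.mp hT hk
  · intro S hS
    rw [Finset.card_erase_of_mem (by simpa using hS)]

lemma sum_pow_card_sub_one_of_nonempty {ι : Type*} [DecidableEq ι] (s : Finset ι) (a : ℕ) :
    ∑ S ∈ s.powerset with S.Nonempty, a ^ (S.card - 1) = ∑ i ∈ Finset.range s.card, (a + 1) ^ i := by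
  simp only [Finset.sum_filter]
  induction s using Finset.induction_on with
  | empty => simp
  | insert b s hb ih =>
    rw [Finset.sum_powerset_insert hb, ih, Finset.card_insert_of_notMem hb, Finset.sum_range_succ]
    congr 1
    have h := Finset.sum_pow_mul_eq_add_pow a 1 s
    simp only [one_pow, mul_one] at h
    rw [← h]
    refine Finset.sum_congr rfl fun T hT => ?_
    rw [if_pos (Finset.insert_nonempty _ _),
      Finset.card_insert_of_notMem fun h => hb (Finset.mem_powerset.mp hT h), Nat.add_sub_cancel]

end Walks

/-- A bijection between subsets of a finite set extends to a permutation. For privacy, it will turn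
the symbols seen by one database under one desired message into those seen under another. -/
lemma exists_perm_of_injOn {α U : Type*} [Finite U] {s : Set α} {f f' : α → U}
    (hf : s.InjOn f) (hf' : s.InjOn f') : ∃ σ : Equiv.Perm U, ∀ a ∈ s, σ (f a) = f' a := by
  classical
  have := Fintype.ofFinite U
  let e : {x // x ∈ f '' s} ≃ {x // x ∈ f' '' s} :=
    (Equiv.Set.imageOfInjOn f s hf).symm.trans (Equiv.Set.imageOfInjOn f' s hf')
  refine ⟨e.extendSubtype, fun a ha => ?_⟩
  rw [e.extendSubtype_apply_of_mem _ ⟨a, ha, rfl⟩]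
  have : (⟨f a, a, ha, rfl⟩ : {x // x ∈ f '' s}) = Equiv.Set.imageOfInjOn f s hf ⟨a, ha⟩ := rfl
  simp only [e, Equiv.trans_apply]
  rw [this, Equiv.symm_apply_apply]
  rfl

/-! ### Labels of sums and their side information -/

section Queries

variable (N K : ℕ) [NeZero N]

/-- A set of messages together with a walk; it stands for the download of a sum of one symbol of
each of these messages from the database at the end of the walk. -/
abbrev SumLabel (N K : ℕ) : Type := Σ _ : Finset (Fin K), List (Fin N)

/-- The labels whose walk has as many steps as there are messages in the sum. -/
def sumLabels : Finset (SumLabel N K) :=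
  Finset.univ.sigma fun S => walks N S.card

/-- The labels of the sums that involve message `k`. -/
abbrev LabelsWith (k : Fin K) : Type := {g // g ∈ (sumLabels N K).filter fun g => k ∈ g.1}

variable {N K}

/-- The sum of undesired symbols, downloaded elsewhere, that is reused in the sum with a given
label, provided that this sum involves the desired message `θ`. -/
def sideLabel (θ : Fin K) (g : SumLabel N K) : SumLabel N K := ⟨g.1.erase θ, g.2.tail⟩

/-- The label that determines which symbol of message `k` occurs in the sum with label `g`. -/
def symbolLabel (θ k : Fin K) (g : SumLabel N K) : SumLabel N K :=
  if θ ∈ g.1 ∧ k ≠ θ then sideLabel θ g else g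

lemma mem_sumLabels {g : SumLabel N K} : g ∈ sumLabels N K ↔ g.2 ∈ walks N g.1.card := by
  simp [sumLabels]

lemma exists_eq_cons_of_mem_sumLabels {θ : Fin K} {g : SumLabel N K} (hg : g ∈ sumLabels N K)
    (hθ : θ ∈ g.1) :
    ∃ n w, g.2 = n :: w ∧ w ∈ walks N (g.1.erase θ).card ∧ n ∈ walkSuccessors w := by
  rw [mem_sumLabels, ← Finset.card_erase_add_one hθ] at hg
  obtain ⟨n, w, hw⟩ := exists_eq_cons_of_mem_walks hg
  rw [hw, cons_mem_walks] at hg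
  exact ⟨n, w, hw, hg⟩

lemma sideLabel_mem {θ : Fin K} {g : SumLabel N K} (hg : g ∈ sumLabels N K) (hθ : θ ∈ g.1) :
    sideLabel θ g ∈ sumLabels N K := by
  obtain ⟨n, w, hw, hw', -⟩ := exists_eq_cons_of_mem_sumLabels hg hθ
  rw [mem_sumLabels]
  simpa [sideLabel, hw] using hw'

lemma symbolLabel_mem {θ k : Fin K} {g : SumLabel N K}
    (hg : g ∈ (sumLabels N K).filter fun g => k ∈ g.1) :
    symbolLabel θ k g ∈ (sumLabels N K).filter fun g => k ∈ g.1 := by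
  rw [Finset.mem_filter] at hg ⊢
  unfold symbolLabel
  split_ifs with h
  · exact ⟨sideLabel_mem hg.1 h.1, Finset.mem_erase.mpr ⟨h.2, hg.2⟩⟩
  · exact hg

/-- No database is asked twice for the same symbol. -/
lemma symbolLabel_injOn (θ k : Fin K) (n : Fin N) :
    Set.InjOn (symbolLabel θ k) {g : SumLabel N K | g ∈ sumLabels N K ∧ g.2.head? = some n} := by
  -- Consecutive databases of a walk differ, so the side information of a sum never comes from the
  -- database that returns this sum.
  have aux {g g' : SumLabel N K} (hg : g ∈ sumLabels N K) (hn : g.2.head? = some n)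
      (hn' : g'.2.head? = some n) (h : θ ∈ g.1) : sideLabel θ g ≠ g' := by
    rintro rfl
    obtain ⟨m, w, hw, -, hm⟩ := exists_eq_cons_of_mem_sumLabels hg h
    simp only [sideLabel, hw, List.tail_cons, List.head?_cons, Option.some.injEq] at hn hn'
    subst hn
    cases w with
    | nil => simp at hn'
    | cons a w =>
      simp only [List.head?_cons, Option.some.injEq] at hn'
      simp [walkSuccessors, hn'] at hm
  rintro g ⟨hg, hn⟩ g' ⟨hg', hn'⟩ h
  unfold symbolLabel at h
  split_ifs at h with h1 h2 h2
  · obtain ⟨m, w, hw, -⟩ := exists_eq_cons_of_mem_sumLabels hg h1.1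
    obtain ⟨m', w', hw', -⟩ := exists_eq_cons_of_mem_sumLabels hg' h2.1
    obtain ⟨S, v⟩ := g
    obtain ⟨S', v'⟩ := g'
    simp only at hw hw' h1 h2
    subst hw hw'
    simp only [List.head?_cons, Option.some.injEq] at hn hn'
    simp only [sideLabel, List.tail_cons, Sigma.mk.injEq, heq_eq_eq] at h
    rw [← Finset.insert_erase h1.1, ← Finset.insert_erase h2.1, h.1, h.2, hn, hn']
  · exact absurd h (aux hg hn hn' h1.1)
  · exact absurd h.symm (aux hg' hn' hn h2.1)
  · exact h

-- This is the message length of `sumScheme`: a set of size s containing `k` carries (N - 1)^(s - 1)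
-- walks.
variable (N) in
lemma card_labelsWith (k : Fin K) : Fintype.card (LabelsWith N K k) = N ^ (K - 1) := by
  have hN : N - 1 + 1 = N := Nat.sub_add_cancel (Nat.one_le_iff_ne_zero.mpr (NeZero.ne N))
  rw [Fintype.card_coe]
  have h : (sumLabels N K).filter (fun g => k ∈ g.1)
      = (Finset.univ.filter fun S : Finset (Fin K) => k ∈ S).sigma fun S => walks N S.card := by
    ext g
    simp [sumLabels, and_comm]
  rw [h, Finset.card_sigma, ← congrArg (· ^ (K - 1)) hN, ← sum_pow_card_sub_one_of_mem k]
  refine Finset.sum_congr rfl fun S hS => ?_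
  have hpos := Finset.card_pos.mpr ⟨k, (Finset.mem_filter.mp hS).2⟩
  rw [← card_walks_succ, Nat.sub_add_cancel hpos]

-- This is the cost of `sumScheme`. Only the empty set, with its empty walk, belongs to no database.
variable (N K) in
lemma sum_card_labels_head :
    ∑ n : Fin N, ((sumLabels N K).filter fun g => g.2.head? = some n).card
      = ∑ i ∈ Finset.range K, N ^ i := by
  have hN : N - 1 + 1 = N := Nat.sub_add_cancel (Nat.one_le_iff_ne_zero.mpr (NeZero.ne N))
  rw [← Finset.card_biUnion]
  · have h : (Finset.univ.biUnion fun n : Fin N =>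
        (sumLabels N K).filter fun g => g.2.head? = some n)
        = ((Finset.univ : Finset (Fin K)).powerset.filter Finset.Nonempty).sigma
          fun S => walks N S.card := by
      ext ⟨S, w⟩
      simp only [sumLabels, Finset.mem_biUnion, Finset.mem_filter, Finset.mem_sigma,
        Finset.mem_univ, true_and, Finset.powerset_univ]
      constructor
      · rintro ⟨n, hw, hn⟩
        refine ⟨Finset.nonempty_iff_ne_empty.mpr ?_, hw⟩
        rintro rfl
        simp [walks] at hw
        simp [hw] at hn
      · rintro ⟨⟨k, hk⟩, hw⟩
        obtain ⟨n, v, hv, -⟩ :=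
          exists_eq_cons_of_mem_sumLabels (g := ⟨S, w⟩) (mem_sumLabels.mpr hw) hk
        simp only at hv
        exact ⟨n, hw, by simp [hv]⟩
    have h2 := sum_pow_card_sub_one_of_nonempty (Finset.univ : Finset (Fin K)) (N - 1)
    rw [hN, Finset.card_univ, Fintype.card_fin] at h2
    rw [h, Finset.card_sigma, ← h2]
    refine Finset.sum_congr rfl fun S hS => ?_
    have hpos := Finset.card_pos.mpr (Finset.mem_filter.mp hS).2
    rw [← card_walks_succ, Nat.sub_add_cancel hpos]
  · intro n _ m _ hnm
    rw [Function.onFun, Finset.disjoint_left]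
    intro g hg hg'
    have h1 := (Finset.mem_filter.mp hg).2
    have h2 := (Finset.mem_filter.mp hg').2
    exact hnm (Option.some.inj (h1.symm.trans h2))

end Queries

/-! ### The capacity-achieving scheme -/

namespace FiniteScheme

variable {N K : ℕ} [NeZero N] {Λ A : Type}

/-- The symbol of message `k` that corresponds to a label, and `0` for labels of other sums. -/
def labelSymbol [Zero A] (π : ∀ k, LabelsWith N K k ≃ Λ) (W : Fin K → Λ → A)
    (k : Fin K) (g : SumLabel N K) : A :=
  if h : g ∈ (sumLabels N K).filter fun g => k ∈ g.1 then W k (π k ⟨g, h⟩) else 0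

/-- The sum with a given label, when message `θ` is desired. -/
def labelSum [AddCommGroup A] (θ : Fin K) (π : ∀ k, LabelsWith N K k ≃ Λ) (W : Fin K → Λ → A)
    (g : SumLabel N K) : A :=
  ∑ k ∈ g.1, labelSymbol π W k (symbolLabel θ k g)

/-- Decoding rule: the undesired symbols of `g` are by construction those of its side label. -/
lemma labelSum_eq_add [AddCommGroup A] {θ : Fin K} (π : ∀ k, LabelsWith N K k ≃ Λ)
    (W : Fin K → Λ → A) {g : SumLabel N K} (hθ : θ ∈ g.1) :
    labelSum θ π W g = labelSymbol π W θ g + labelSum θ π W (sideLabel θ g) := by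
  unfold labelSum
  rw [← Finset.add_sum_erase _ _ hθ]
  congr 1
  · simp [symbolLabel]
  · refine Finset.sum_congr rfl fun k hk => ?_
    have : θ ∉ (sideLabel θ g).1 := Finset.notMem_erase _ _
    simp [symbolLabel, hθ, Finset.ne_of_mem_erase hk, this]

/-- The scheme that downloads all the sums with labels in `sumLabels`, for messages whose symbols
are identified with the labels by secret random bijections. -/
noncomputable def sumScheme [AddCommGroup A] [Fintype Λ] (hΛ : Fintype.card Λ = N ^ (K - 1)) :
    FiniteScheme N K Λ A where
  Ω := ∀ k, LabelsWith N K k ≃ Λ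
  fintypeΩ := by classical exact inferInstance
  nonemptyΩ := ⟨fun k => Fintype.equivOfCardEq ((card_labelsWith N k).trans hΛ.symm)⟩
  Index n := {g // g ∈ (sumLabels N K).filter fun g => g.2.head? = some n}
  fintypeIndex _ := Finset.fintypeCoeSort _
  answer θ _ π W g := labelSum θ π W g
  correct θ π W W' h := by
    have key (g : SumLabel N K) (hg : g ∈ sumLabels N K) :
        labelSum θ π W g = labelSum θ π W' g := by
      -- The empty sum is not downloaded, but it is known to be zero.
      rcases Finset.eq_empty_or_nonempty g.1 with h0 | ⟨k, hk⟩
      · simp [labelSum, h0]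
      · obtain ⟨n, w, hw, -⟩ := exists_eq_cons_of_mem_sumLabels hg hk
        exact congrFun (h n) ⟨g, Finset.mem_filter.mpr ⟨hg, by simp [hw]⟩⟩
    ext i
    obtain ⟨⟨g, hg⟩, rfl⟩ := (π θ).surjective i
    have hg' := Finset.mem_filter.mp hg
    have h1 := key g hg'.1
    rw [labelSum_eq_add π W hg'.2, labelSum_eq_add π W' hg'.2,
      key _ (sideLabel_mem hg'.1 hg'.2)] at h1
    simpa [labelSymbol, hg'.1, hg'.2] using add_right_cancel h1
  isPrivate n θ θ' := by
    have h (k : Fin K) : ∃ σ : Equiv.Perm (LabelsWith N K k), ∀ g : LabelsWith N K k,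
        g.1.2.head? = some n → σ ⟨symbolLabel θ k g.1, symbolLabel_mem g.2⟩
          = ⟨symbolLabel θ' k g.1, symbolLabel_mem g.2⟩ := by
      have inj (θ : Fin K) : Set.InjOn (fun g : LabelsWith N K k =>
          (⟨symbolLabel θ k g.1, symbolLabel_mem g.2⟩ : LabelsWith N K k))
          {g | g.1.2.head? = some n} := fun g hg g' hg' hgg' =>
        Subtype.ext (symbolLabel_injOn θ k n ⟨(Finset.mem_filter.mp g.2).1, hg⟩
          ⟨(Finset.mem_filter.mp g'.2).1, hg'⟩ (congrArg Subtype.val hgg'))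
      exact exists_perm_of_injOn (inj θ) (inj θ')
    choose σ hσ using h
    -- Each secret bijection `π k` is precomposed with `σ k`.
    refine ⟨Equiv.piCongrRight fun k => Equiv.equivCongr (σ k).symm (Equiv.refl Λ), fun π => ?_⟩
    ext W ⟨g, hg⟩
    rw [Finset.mem_filter] at hg
    refine Finset.sum_congr rfl fun k hk => ?_
    have hk' : g ∈ (sumLabels N K).filter fun g => k ∈ g.1 := Finset.mem_filter.mpr ⟨hg.1, hk⟩
    have h1 := symbolLabel_mem (θ := θ) hk'
    have h2 := symbolLabel_mem (θ := θ') hk'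
    rw [labelSymbol, labelSymbol, dif_pos h1, dif_pos h2, ← hσ k ⟨g, hk'⟩ hg.2]
    rfl

lemma cost_sumScheme [AddCommGroup A] [Fintype Λ] (hΛ : Fintype.card Λ = N ^ (K - 1)) :
    (sumScheme hΛ : FiniteScheme N K Λ A).cost = ∑ i ∈ Finset.range K, N ^ i := by
  rw [← sum_card_labels_head]
  exact Finset.sum_congr rfl fun n _ => Fintype.card_coe _

end FiniteScheme

/-! ### Combining schemes for arbitrary message lengths -/

namespace FiniteScheme

variable {N K : ℕ} {A : Type}

lemma cost_congr {Λ Λ' : Type} (S : FiniteScheme N K Λ A) (e : Λ ≃ Λ') :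
    (S.congr e).cost = S.cost := rfl

lemma cost_sum {Λ Λ' : Type} (S : FiniteScheme N K Λ A) (S' : FiniteScheme N K Λ' A) :
    (S.sum S').cost = S.cost + S'.cost := by
  unfold cost
  rw [← Finset.sum_add_distrib]
  exact Finset.sum_congr rfl fun n _ => Fintype.card_sum

lemma exists_cost_add {L L' D D' : ℕ} (h : ∃ S : FiniteScheme N K (Fin L) A, S.cost = D)
    (h' : ∃ S : FiniteScheme N K (Fin L') A, S.cost = D') :
    ∃ S : FiniteScheme N K (Fin (L + L')) A, S.cost = D + D' := by
  obtain ⟨S, rfl⟩ := h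
  obtain ⟨S', rfl⟩ := h'
  exact ⟨(S.sum S').congr finSumFinEquiv, by rw [cost_congr, cost_sum]⟩

lemma exists_cost_zero : ∃ S : FiniteScheme N K (Fin 0) A, S.cost = 0 :=
  ⟨trivialScheme, Finset.sum_eq_zero fun _ _ => Fintype.card_empty⟩

lemma exists_cost_mul {L D : ℕ} (h : ∃ S : FiniteScheme N K (Fin L) A, S.cost = D) (y : ℕ) :
    ∃ S : FiniteScheme N K (Fin (y * L)) A, S.cost = y * D := by
  induction y with
  | zero =>
    rw [zero_mul, zero_mul]
    exact exists_cost_zero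
  | succ y ih =>
    rw [add_one_mul, add_one_mul]
    exact exists_cost_add ih h

/-- Short messages, retrieved in pieces of at most `N - 1` symbols. -/
lemma exists_cost_short [AddCommGroup A] (hN : 2 ≤ N) (r : ℕ) :
    ∃ c : ℕ, (N - 1) * c ≤ r + (N - 2) ∧
      ∃ S : FiniteScheme N K (Fin r) A, S.cost = r + c := by
  have h1 := exists_cost_mul (N := N) (K := K) (A := A)
    ⟨cyclicScheme (by omega : N - 1 + 1 ≤ N), cost_cyclicScheme _⟩ (r / (N - 1))
  have hr := Nat.div_add_mod' r (N - 1)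
  have hlt := Nat.mod_lt r (by omega : 0 < N - 1)
  set a := r / (N - 1)
  set b := r % (N - 1)
  -- The overhead `c` is the number of pieces, r / (N - 1) rounded up.
  rcases Nat.eq_zero_or_pos b with hb | hb
  · refine ⟨a, by rw [mul_comm]; omega, ?_⟩
    rw [hb, add_zero] at hr
    rwa [mul_add_one, hr] at h1
  · refine ⟨a + 1, by rw [mul_add_one, mul_comm]; omega, ?_⟩
    have h2 := exists_cost_add h1
      ⟨cyclicScheme (by omega : b + 1 ≤ N), cost_cyclicScheme _⟩
    rw [hr] at h2
    convert h2 using 2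
    rw [mul_add_one]
    omega

/-- Messages of any length can be retrieved at a cost less than `L / C + 1`. -/
lemma exists_cost_lt [AddCommGroup A] (hN : 1 ≤ N) (hK : 1 ≤ K) (L : ℕ) :
    ∃ S : FiniteScheme N K (Fin L) A, (S.cost : ℝ) < L / pirCapacity N K + 1 := by
  have : NeZero N := ⟨by omega⟩
  have hN0 : (0 : ℝ) < N := by exact_mod_cast hN
  have h1 := exists_cost_mul (N := N) (K := K) (A := A)
    ⟨sumScheme (Fintype.card_fin _), cost_sumScheme _⟩ (L / N ^ (K - 1))
  have hL := Nat.div_add_mod' L (N ^ (K - 1))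
  have hr := Nat.mod_lt L (pow_pos hN (K - 1))
  set y := L / N ^ (K - 1)
  set r := L % N ^ (K - 1)
  set T : ℝ := ∑ i ∈ Finset.range K, 1 / (N : ℝ) ^ i with hT
  have hsum : ((∑ i ∈ Finset.range K, N ^ i : ℕ) : ℝ) = (N : ℝ) ^ (K - 1) * T := by
    rw [← Finset.sum_range_reflect, hT, Finset.mul_sum]
    push_cast
    refine Finset.sum_congr rfl fun i hi => ?_
    have hi := Finset.mem_range.mp hi
    rw [mul_one_div, eq_div_iff (by positivity), ← pow_add]
    congr 1
    omega
  have hLT : (L : ℝ) / pirCapacity N K = y * ((N : ℝ) ^ (K - 1) * T) + r * T := by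
    rw [pirCapacity, div_inv_eq_mul, ← hL]
    push_cast
    ring
  rcases Nat.lt_or_ge N 2 with h | h
  -- With one database, blocks have length 1 and nothing is left over.
  · obtain rfl : N = 1 := by omega
    have hr0 : r = 0 := by simpa using hr
    rw [hr0, add_zero] at hL
    rw [hL] at h1
    obtain ⟨S, hS⟩ := h1
    refine ⟨S, ?_⟩
    rw [hLT, hS, Nat.cast_mul, hsum, hr0]
    simp
  · obtain ⟨c, hc, h2⟩ := exists_cost_short (K := K) (A := A) h r
    have h3 := exists_cost_add h1 h2
    rw [hL] at h3
    obtain ⟨S, hS⟩ := h3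
    refine ⟨S, ?_⟩
    rw [hLT, hS]
    push_cast only [Nat.cast_add, Nat.cast_mul]
    rw [hsum]
    have hgeom : ((N : ℝ) - 1) * T = N - 1 / (N : ℝ) ^ (K - 1) := by
      have h4 : ((∑ i ∈ Finset.range K, N ^ i : ℕ) : ℝ) * ((N : ℝ) - 1) = (N : ℝ) ^ K - 1 := by
        push_cast
        exact geom_sum_mul _ _
      rw [hsum, ← Nat.sub_add_cancel hK, pow_succ, Nat.add_sub_cancel] at h4
      have : (N : ℝ) ^ (K - 1) ≠ 0 := by positivity
      field_simp
      linarith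
    -- The strict inequality rests on the remainder being smaller than a block.
    have hr' : (r : ℝ) * (1 / (N : ℝ) ^ (K - 1)) < 1 := by
      rw [mul_one_div, div_lt_one (by positivity)]
      exact_mod_cast hr
    have hc' : ((N : ℝ) - 1) * c ≤ r + (N - 2) := by
      have : (((N - 1) * c : ℕ) : ℝ) ≤ ((r + (N - 2) : ℕ) : ℝ) := by exact_mod_cast hc
      rwa [Nat.cast_mul, Nat.cast_add, Nat.cast_sub hN, Nat.cast_sub h, Nat.cast_one,
        Nat.cast_ofNat] at this
    have hN1 : (0 : ℝ) < (N : ℝ) - 1 := by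
      have : (2 : ℝ) ≤ N := by exact_mod_cast h
      linarith
    suffices (r : ℝ) + c < r * T + 1 by linarith
    refine lt_of_mul_lt_mul_left ?_ hN1.le
    have : ((N : ℝ) - 1) * (r * T + 1) = r * (((N : ℝ) - 1) * T) + (N - 1) := by ring
    rw [this, hgeom]
    linarith

end FiniteScheme

/-! ### From finite schemes to random queries -/

lemma PMF.map_uniformOfFintype_equiv {Ω : Type*} [Fintype Ω] [Nonempty Ω] (σ : Equiv.Perm Ω) :
    (PMF.uniformOfFintype Ω).map σ = PMF.uniformOfFintype Ω := by
  ext a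
  rw [PMF.map_apply, tsum_eq_single (σ.symm a)]
  · simp
  · intro b hb
    rw [if_neg]
    rintro rfl
    simp at hb

lemma PMF.measure_map_uniformOfFintype_equiv {Ω : Type*} [Fintype Ω] [Nonempty Ω]
    [MeasurableSpace Ω] (σ : Equiv.Perm Ω) (hσ : Measurable σ) :
    (PMF.uniformOfFintype Ω).toMeasure.map σ = (PMF.uniformOfFintype Ω).toMeasure := by
  rw [PMF.toMeasure_map _ _ hσ, PMF.map_uniformOfFintype_equiv]

namespace FiniteScheme

variable {N K L M : ℕ}

/-- A finite scheme as a scheme with random queries. -/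
noncomputable def toPIRScheme [NeZero M] (S : FiniteScheme N K (Fin L) (Fin M)) :
    PIRScheme N K L M where
  Ω := S.Ω
  measΩ := ⊤
  μ := @PMF.toMeasure _ ⊤ (PMF.uniformOfFintype S.Ω)
  prob := @PMF.toMeasure.isProbabilityMeasure _ ⊤ _
  Query n := Messages K L M → S.Index n → Fin M
  measQuery _ := ⊤
  singletonQuery _ := @MeasurableSingletonClass.mk _ ⊤ fun _ => trivial
  query := S.answer
  measurable_query _ _ _ _ := trivial
  answerLength n _ := Fintype.card (S.Index n)
  answer n q W := List.ofFn fun i => q W ((Fintype.equivFin (S.Index n)).symm i)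
  length_answer _ _ _ := List.length_ofFn
  measurable_answer _ _ _ := trivial
  correct θ := by
    classical
    -- Decoding picks any messages consistent with the answers; all of them agree on message `θ`.
    -- The default 0 is never reached on actual answers.
    refine ⟨fun q a => if h : ∃ W, ∀ n, (List.ofFn fun i =>
      q n W ((Fintype.equivFin (S.Index n)).symm i)) = a n then h.choose θ else fun _ => 0,
      fun W => Filter.Eventually.of_forall fun ω => ?_⟩
    have h : ∃ V, ∀ n, (List.ofFn fun i =>
        S.answer θ n ω V ((Fintype.equivFin (S.Index n)).symm i))
        = List.ofFn fun i => S.answer θ n ω W ((Fintype.equivFin (S.Index n)).symm i) :=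
      ⟨W, fun _ => rfl⟩
    refine (dif_pos h).trans ?_
    refine S.correct θ ω _ _ fun n => funext fun i => ?_
    simpa using congrFun (List.ofFn_injective (h.choose_spec n)) (Fintype.equivFin _ i)
  isPrivate n θ θ' := by
    let _ : MeasurableSpace S.Ω := ⊤
    let _ : MeasurableSpace (Messages K L M → S.Index n → Fin M) := ⊤
    obtain ⟨σ, hσ⟩ := S.isPrivate n θ θ'
    refine ⟨measurable_from_top.aemeasurable, measurable_from_top.aemeasurable, ?_⟩
    have h : S.answer θ' n = S.answer θ n ∘ σ := funext fun ω => (hσ ω).symm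
    rw [h, ← Measure.map_map measurable_from_top measurable_from_top,
      PMF.measure_map_uniformOfFintype_equiv σ measurable_from_top]

lemma isDownloadCost_toPIRScheme [NeZero M] (hK : 1 ≤ K) (S : FiniteScheme N K (Fin L) (Fin M)) :
    S.toPIRScheme.IsDownloadCost S.cost := by
  refine ⟨fun θ => Filter.Eventually.of_forall fun ω => le_rfl, fun d hd => ?_⟩
  -- The download is constant, so a single realization of an almost sure bound suffices.
  obtain ⟨ω, hω⟩ := (hd ⟨0, hK⟩).exists
  exact hω

end FiniteScheme

theorem theorem1 (N K L M : ℕ) (hN : 1 ≤ N) (hK : 1 ≤ K) (hM : 2 ≤ M) :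
    IsLeast {D : ℕ | ∃ S : PIRScheme N K L M, S.IsDownloadCost D}
      ⌈(L : ℝ) / pirCapacity N K⌉₊ := by
  have converse (D : ℕ) (hD : ∃ S : PIRScheme N K L M, S.IsDownloadCost D) :
      ⌈(L : ℝ) / pirCapacity N K⌉₊ ≤ D := by
    obtain ⟨S, hS⟩ := hD
    exact Nat.ceil_le.mpr (S.div_pirCapacity_le hN hK hM hS)
  refine ⟨?_, converse⟩
  have : NeZero M := ⟨by omega⟩
  obtain ⟨S, hS⟩ := FiniteScheme.exists_cost_lt (A := Fin M) hN hK L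
  have hcost := S.isDownloadCost_toPIRScheme hK
  have h : S.cost = ⌈(L : ℝ) / pirCapacity N K⌉₊ := by
    refine le_antisymm (Nat.lt_succ_iff.mp ?_) (converse _ ⟨_, hcost⟩)
    have h1 : (S.cost : ℝ) < (⌈(L : ℝ) / pirCapacity N K⌉₊ : ℝ) + 1 :=
      hS.trans_le (add_le_add_left (Nat.le_ceil _) 1)
    exact_mod_cast h1
  exact ⟨S.toPIRScheme, h ▸ hcost⟩
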